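/- A median algebra is a set $M$ with a map $m\colon M^3\to M$ that is invariant under permutations of its three arguments and satisfies $m(x,x,y)=x$ and $m(m(x,y,z),y,w)=m(x,y,m(z,y,w))$ for all $x,y,z,w\in M$. Its rank is the supremum of the $k\in\mathbb{N}$ for which $M$ contains a median subalgebra isomorphic to $\{0,1\}^k$ (with the componentwise majority operation). A subset $C\subseteq M$ is convex if $m(x,y,z)\in C$ for all $x,y\in C$ and $z\in M$; a halfspace is a nonempty convex subset $\mathfrak{h}\subseteq M$ whose complement $\mathfrak{h}^*$ is nonempty and convex; a wall is an unordered pair $\{\mathfrak{h},\mathfrak{h}^*\}$ with $\mathfrak{h}$ a halfspace, and $\mathscr{W}(x|y)$ denotes the set of walls having $x$ and $y$ on different sides. An automorphism $g$ of $M$ (a bijection of $M$ preserving $m$) is semisimple if there exists $x\in M$ such that the sets $\mathscr{W}(g^nx\,|\,g^{n+1}x)$, $n\in\mathbb{Z}$, are pairwise disjoint. It acts stably without wall inversions if there are no halfspace $\mathfrak{h}$ and no $n\in\mathbb{Z}$ with $g^n\mathfrak{h}=\mathfrak{h}^*$. Corollary. Let $M$ be a nonempty median algebra of finite rank $r$.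 (1) If $g\in\mathrm{Aut}(M)$ acts stably without wall inversions, then $g$ is semisimple. (2) For every $g\in\mathrm{Aut}(M)$ there exists an integer $i$ with $1\le i\le 2^r$ such that $g^i$ is semisimple. -/

import Mathlib

/-- A median algebra: a ternary operation `med` which is symmetric, satisfies `med x x y = x`,
and for which `(x, z) ↦ med x y z` is associative for every `y`. -/
class MedianAlgebra (M : Type*) where
  /-- the median operator -/
  med : M → M → M → M
  med_self : ∀ x y, med x x y = x
  med_swap_left : ∀ x y z, med x y z = med y x z
  med_swap_right : ∀ x y z, med x y z = med x z y
  med_assoc : ∀ x y z w, med (med x y z) y w = med x y (med z y w)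

namespace MedianAlgebra

/-- The two-point median algebra `{0,1}`, with the majority operator. -/
instance instBool : MedianAlgebra Bool where
  med x y z := (x && y) || (y && z) || (x && z)
  med_self := by decide
  med_swap_left := by decide
  med_swap_right := by decide
  med_assoc := by decide

/-- Products of median algebras, with the componentwise operator. -/
instance instPi {ι : Type*} {N : ι → Type*} [∀ i, MedianAlgebra (N i)] :
    MedianAlgebra (∀ i, N i) where
  med x y z := fun i => med (x i) (y i) (z i)
  med_self _ _ := funext fun _ => med_self _ _
  med_swap_left _ _ _ := funext fun _ => med_swap_left _ _ _
  med_swap_right _ _ _ := funext fun _ => med_swap_right _ _ _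
  med_assoc _ _ _ _ := funext fun _ => med_assoc _ _ _ _

/-- Median morphisms. -/
def IsMorphism {M N : Type*} [MedianAlgebra M] [MedianAlgebra N] (f : M → N) : Prop :=
  ∀ x y z, f (med x y z) = med (f x) (f y) (f z)

/-- `M` contains a median subalgebra isomorphic to the cube `{0,1}^k`
(namely the image of an injective median morphism from the cube). -/
def ContainsCube (M : Type*) [MedianAlgebra M] (k : ℕ) : Prop :=
  ∃ f : (Fin k → Bool) → M, IsMorphism f ∧ Function.Injective f

/-- The rank of `M`: the supremum of the `k` for which `M` contains a copy of `{0,1}^k`. -/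
noncomputable def rank (M : Type*) [MedianAlgebra M] : ℕ∞ :=
  ⨆ (k : ℕ) (_ : ContainsCube M k), (k : ℕ∞)

variable {M : Type*} [MedianAlgebra M]

/-- Convex subsets of a median algebra. -/
def IsConvex (C : Set M) : Prop :=
  ∀ x ∈ C, ∀ y ∈ C, ∀ z, med x y z ∈ C

/-- Halfspaces: nonempty convex subsets with nonempty convex complement. -/
def IsHalfspace (h : Set M) : Prop :=
  h.Nonempty ∧ hᶜ.Nonempty ∧ IsConvex h ∧ IsConvex hᶜ

/-- Walls: unordered pairs formed by a halfspace and its complement. -/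
def IsWall (w : Sym2 (Set M)) : Prop :=
  ∃ h : Set M, IsHalfspace h ∧ w = s(h, hᶜ)

/-- `𝒲(x|y)`: the set of walls that separate `x` from `y`. -/
def wallsBetween (x y : M) : Set (Sym2 (Set M)) :=
  {w | IsWall w ∧ ∃ h ∈ w, x ∈ h ∧ y ∉ h}

variable (M) in
/-- The group of median automorphisms of `M`, as a group of permutations. -/
def Aut : Subgroup (Equiv.Perm M) where
  carrier := {g | IsMorphism (g : M → M)}
  one_mem' := fun _ _ _ => rfl
  mul_mem' := by
    intro a b ha hb x y z
    rw [Equiv.Perm.mul_apply, hb, ha]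
    rfl
  inv_mem' := by
    intro a ha x y z
    apply a.injective
    rw [ha]
    simp

variable (M) in
/-- An action is without wall inversions if no group element maps a halfspace to its complement. -/
def ActsWithoutWallInversions (G : Type*) [Group G] [MulAction G M] : Prop :=
  ¬ ∃ (h : Set M) (g : G), IsHalfspace h ∧ (fun x => g • x) '' h = hᶜ

/-- `g` acts stably without wall inversions: the action of `⟨g⟩` is without wall inversions. -/
def StablyWithoutWallInversions (g : Aut M) : Prop :=
  ActsWithoutWallInversions M (Subgroup.zpowers g)

/-- The minimal set of `g`: the points `x` such that the sets `𝒲(gⁿx|gⁿ⁺¹x)`, for `n ∈ ℤ`,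
are pairwise disjoint. -/
def minSet (g : Aut M) : Set M :=
  {x | Pairwise fun m n : ℤ =>
    Disjoint (wallsBetween ((g ^ m) • x) ((g ^ (m + 1)) • x))
      (wallsBetween ((g ^ n) • x) ((g ^ (n + 1)) • x))}

/-- `g` is semisimple if its minimal set is nonempty. -/
def IsSemisimple (g : Aut M) : Prop :=
  (minSet g).Nonempty

end MedianAlgebra

/-!
Everything is read off from the halfspaces of `M`. Finite rank enters through
`card_le_of_transverse`: pairwise transverse halfspaces are at most `r` in number, since `k` of
them give a copy of `{0,1}^k`. Its proof needs only that distinct points are separated by a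
halfspace (`exists_isBiconvex_mem_notMem`), so that identities in `M` can be checked on
halfspaces, where the median is majority.

The main tool is `exists_forall_mem`: a family of pairwise intersecting biconvex sets that is
closed under intersections of chains has a common point. Given a point `x`, the minimal members of
the family that miss `x` are pairwise transverse, hence finite in number, so Helly's theorem yields
points `x₀`, `x₁`, `x₂` such that no minimal member misses two of them; their median is in every
member.

Let `g` act stably without wall inversions and put `N = r!`. Writing `gⁿ h` for a translate:

* The biconvex sets `h` with `h ∪ gⁿ h = M` for some `1 ≤ n ≤ N` form a family as above; they
  intersect pairwise because otherwise a wall would be inverted. Take `x` in all of them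
  (`StablyWithoutWallInversions.exists_mem_core`). A halfspace `h` that separates two points of the
  orbit of `x` then neither covers `M` together with any of these translates nor is disjoint from
  one, and as it is not transverse to all of its first `r` translates, `g^N h` and `h` are nested.
* If some such `h` satisfy `g^N h = h`, then `x` can be moved into the intersection of the
  translates of a minimal one, which is transverse to all such halfspaces for the new point. After
  at most `r` moves no `g^N`-periodic halfspace is left (`exists_no_periodic`).
* Now each orbit sequence `i ↦ (gⁱ x ∈ h)` is monotone along residue classes modulo `N`, and
  a compactness argument bounds, uniformly in `h`, the time within which all classes change their
  value (`exists_uniform_bound`). The majority vote along a segment of the orbit that is long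
  compared with this bound defines a family of halfspaces as above, and the sequences of a common
  point `y` are monotone (`majority_step`). Thus each wall separates `gⁿ y` from `gⁿ⁺¹ y` for at
  most one `n`, and `g` is semisimple.

For arbitrary `g` the power with exponent `2 ^ r` acts stably without wall inversions
(`stablyWithoutWallInversions_pow`): if a halfspace `h` is inverted by `γ ^ 2 ^ r`, its orbit under
`γ` is finite, so the translates `h, γ h, …, γ^r h` would be pairwise transverse.
-/

namespace MedianAlgebra

variable {M : Type*} [MedianAlgebra M]

/-! ### Betweenness and gates -/

/-- `Btw a x b`: the point `x` lies in the interval between `a` and `b`. For fixed `a` this is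
also the partial order `x ≤ b` of the meet semilattice `(x, y) ↦ med a x y` with least element
`a`. -/
def Btw (a x b : M) : Prop := med a x b = x

theorem btw_iff {a x b : M} : Btw a x b ↔ med x a b = x := by
  rw [Btw, med_swap_left]

theorem Btw.symm {a x b : M} (h : Btw a x b) : Btw b x a := by
  rw [Btw, med_swap_left, med_swap_right, med_swap_left]; exact h

theorem btw_refl (a x : M) : Btw a x x := by
  rw [Btw, med_swap_left, med_swap_right, med_self]

theorem Btw.antisymm {a x y : M} (h : Btw a x y) (h' : Btw a y x) : x = y := by
  rw [Btw] at h h'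
  rw [← h, med_swap_right, h']

theorem Btw.trans {a x y z : M} (h : Btw a x y) (h' : Btw a y z) : Btw a x z := by
  rw [btw_iff] at *
  rw [← h, med_assoc, h']

theorem btw_med_left (a x y : M) : Btw a (med a x y) x := by
  rw [btw_iff, med_swap_left a x y, med_swap_right x a y, med_swap_left x y a,
    med_swap_right y x a, med_assoc, med_swap_right x a x, med_self]

theorem btw_med_right (a x y : M) : Btw a (med a x y) y := by
  rw [med_swap_right]; exact btw_med_left a y x

theorem btw_med_mid (a x y : M) : Btw x (med a x y) y := by
  rw [med_swap_left]; exact btw_med_right x a y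

/-- `med a x y` is the greatest lower bound of `x` and `y` in the order based at `a`. -/
theorem Btw.le_med {a x y z : M} (hx : Btw a z x) (hy : Btw a z y) : Btw a z (med a x y) := by
  rw [btw_iff] at *
  rw [med_swap_left a x y, ← med_assoc, hx, hy]

theorem Btw.rebase {a x y b : M} (h : Btw a x b) (h' : Btw a y x) : Btw y x b := by
  have h1 : med y x a = y := by rw [med_swap_right, ← btw_iff]; exact h'
  have h2 : med a x b = x := h
  rw [Btw, ← h1, med_assoc, h2]
  exact btw_refl y x

/-- `med a x y` is the gate of `a` in the interval between `x` and `y`. -/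
theorem btw_gate (a : M) {x t y : M} (h : Btw x t y) : Btw a (med a x y) t := by
  -- `med a x t` lies both between `x` and `med a x y`, and between `a` and `t`
  have hux : Btw x (med a x t) (med a x y) := by
    rw [med_swap_left a x y]
    refine Btw.le_med ?_ ?_
    · rw [med_swap_left]; exact btw_med_left x a t
    · exact (btw_med_mid a x t).trans h
  have hpu : Btw a (med a x y) (med a x t) :=
    ((btw_med_left a x y).symm.rebase hux).symm
  exact hpu.trans (btw_med_right a x t)

/-- The join of a convex set with a point is convex. -/
theorem IsConvex.join {C : Set M} (hC : IsConvex C) (p : M) :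
    IsConvex {t | ∃ c ∈ C, Btw c t p} := by
  rintro u ⟨c, hc, hu⟩ v ⟨d, hd, hv⟩ z
  -- the witness is the gate of `w = med u v z` in the interval between `c` and `d`
  refine ⟨med c d (med u v z), hC c hc d hd _, ?_⟩
  set w := med u v z with hw
  have hwuv : Btw u w v := by
    rw [hw, med_swap_right, med_swap_left]; exact btw_med_mid z u v
  -- the meet of `p`, `c`, `d` in the order based at `w` is below `u` and `v`, hence equal to `w`
  have h1 : Btw w (med w p (med w c d)) u := by
    refine Btw.trans (Btw.le_med ?_ ?_) (btw_gate w hu)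
    · exact (btw_med_right _ _ _).trans (btw_med_left _ _ _)
    · exact btw_med_left _ _ _
  have h2 : Btw w (med w p (med w c d)) v := by
    refine Btw.trans (Btw.le_med ?_ ?_) (btw_gate w hv)
    · exact (btw_med_right _ _ _).trans (btw_med_right _ _ _)
    · exact btw_med_left _ _ _
  have h3 : Btw w (med w p (med w c d)) (med w u v) := h1.le_med h2
  have h4 : med w u v = w := by rw [med_swap_left]; exact hwuv
  have h5 : med w p (med w c d) = w := by
    rw [h4, Btw] at h3
    rw [← h3, med_swap_right, med_self]
  rw [Btw, med_swap_right c d w, med_swap_left c w d, med_swap_left, med_swap_right]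
  exact h5

/-- The Pasch axiom: in a triangle `p c d'`, segments from `c` and from `d'` to points of the
opposite sides meet. -/
theorem pasch {c d p c' d' : M} (h : Btw c d p) (h' : Btw d' c' p) :
    ∃ z, Btw c z c' ∧ Btw d z d' := by
  refine ⟨med c c' d, ?_, ?_⟩
  · rw [med_swap_right, med_swap_left]; exact btw_med_mid d c c'
  set z := med c c' d with hz
  have hzd : Btw c z d := by
    rw [hz, med_swap_left]; exact btw_med_mid c' c d
  have hzc : Btw d z c' := (btw_med_mid c c' d).symm
  have hdp : Btw z d p := h.rebase hzd
  have h1 : Btw z (med z d d') c' :=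
    (Btw.le_med (btw_med_right z d d') ((btw_med_left z d d').trans hdp)).trans (btw_gate z h')
  have h2 : Btw z (med z d d') (med z c' d) := h1.le_med (btw_med_left z d d')
  have h3 : med z c' d = z := btw_iff.1 hzc.symm
  have h4 : med z d d' = z := by
    rw [h3, Btw, med_swap_right, med_self] at h2
    exact h2.symm
  rw [btw_iff]
  exact h4

/-! ### Biconvex sets -/

/-- A set is biconvex if it and its complement are convex: a halfspace, the empty set, or
everything. -/
def IsBiconvex (h : Set M) : Prop := IsConvex h ∧ IsConvex hᶜ

theorem IsBiconvex.compl {h : Set M} (hh : IsBiconvex h) : IsBiconvex hᶜ :=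
  ⟨hh.2, by rw [compl_compl]; exact hh.1⟩

theorem IsHalfspace.isBiconvex {h : Set M} (hh : IsHalfspace h) : IsBiconvex h := hh.2.2

theorem IsBiconvex.isHalfspace {h : Set M} (hh : IsBiconvex h) {x y : M} (hx : x ∈ h)
    (hy : y ∉ h) : IsHalfspace h :=
  ⟨⟨x, hx⟩, ⟨y, hy⟩, hh⟩

theorem IsConvex.med_mem₁₃ {C : Set M} (hC : IsConvex C) {x y z : M} (hx : x ∈ C) (hz : z ∈ C) :
    med x y z ∈ C := by
  rw [med_swap_right]; exact hC x hx z hz y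

theorem IsConvex.med_mem₂₃ {C : Set M} (hC : IsConvex C) {x y z : M} (hy : y ∈ C) (hz : z ∈ C) :
    med x y z ∈ C := by
  rw [med_swap_left]; exact hC.med_mem₁₃ hy hz

/-- Membership of a median in a biconvex set is decided by majority. -/
theorem IsBiconvex.med_mem {h : Set M} (hh : IsBiconvex h) {x y z : M} :
    med x y z ∈ h ↔ (x ∈ h ∧ y ∈ h) ∨ (y ∈ h ∧ z ∈ h) ∨ (x ∈ h ∧ z ∈ h) := by
  have h1 : x ∈ h → y ∈ h → med x y z ∈ h := fun hx hy => hh.1 x hx y hy z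
  have h2 : y ∈ h → z ∈ h → med x y z ∈ h := hh.1.med_mem₂₃
  have h3 : x ∈ h → z ∈ h → med x y z ∈ h := hh.1.med_mem₁₃
  have h1' : x ∉ h → y ∉ h → med x y z ∉ h := fun hx hy => hh.2 x hx y hy z
  have h2' : y ∉ h → z ∉ h → med x y z ∉ h := fun hy hz => hh.2.med_mem₂₃ hy hz
  have h3' : x ∉ h → z ∉ h → med x y z ∉ h := fun hx hz => hh.2.med_mem₁₃ hx hz
  tauto

theorem isConvex_sUnion_of_isChain {𝒞 : Set (Set M)} (hc : IsChain (· ⊆ ·) 𝒞)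
    (h : ∀ C ∈ 𝒞, IsConvex C) : IsConvex (⋃₀ 𝒞) := by
  rintro x ⟨C, hC, hx⟩ y ⟨D, hD, hy⟩ z
  rcases hc.total hC hD with hCD | hCD
  · exact ⟨D, hD, h D hD x (hCD hx) y hy z⟩
  · exact ⟨C, hC, h C hC x hx y (hCD hy) z⟩

theorem isConvex_sInter {𝒞 : Set (Set M)} (h : ∀ C ∈ 𝒞, IsConvex C) : IsConvex (⋂₀ 𝒞) :=
  fun x hx y hy z C hC => h C hC x (hx C hC) y (hy C hC) z

theorem isBiconvex_sInter_of_isChain {𝒞 : Set (Set M)} (hc : IsChain (· ⊆ ·) 𝒞)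
    (h : ∀ C ∈ 𝒞, IsBiconvex C) : IsBiconvex (⋂₀ 𝒞) := by
  refine ⟨isConvex_sInter fun C hC => (h C hC).1, ?_⟩
  rw [Set.compl_sInter]
  refine isConvex_sUnion_of_isChain ?_ ?_
  · rintro _ ⟨C, hC, rfl⟩ _ ⟨D, hD, rfl⟩ _
    rcases hc.total hC hD with hCD | hCD
    · exact Or.inr (Set.compl_subset_compl.2 hCD)
    · exact Or.inl (Set.compl_subset_compl.2 hCD)
  · rintro _ ⟨C, hC, rfl⟩
    exact (h C hC).2

/-- A maximal convex set among those disjoint from a given set. -/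
theorem exists_maximal_isConvex_disjoint {A B : Set M} (hA : IsConvex A) (hAB : Disjoint A B) :
    ∃ C, A ⊆ C ∧ Maximal (fun C => IsConvex C ∧ Disjoint C B) C := by
  refine zorn_subset_nonempty {C | IsConvex C ∧ Disjoint C B} ?_ A ⟨hA, hAB⟩
  intro 𝒞 h𝒞 hc _
  refine ⟨⋃₀ 𝒞, ⟨isConvex_sUnion_of_isChain hc fun C hC => (h𝒞 hC).1, ?_⟩,
    fun C hC => Set.subset_sUnion_of_mem hC⟩
  rw [Set.disjoint_sUnion_left]
  exact fun C hC => (h𝒞 hC).2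

/-- Distinct points are separated by a halfspace. -/
theorem exists_isBiconvex_mem_notMem {x y : M} (hxy : x ≠ y) :
    ∃ h : Set M, IsBiconvex h ∧ x ∈ h ∧ y ∉ h := by
  have hs : ∀ x : M, IsConvex {x} := by
    rintro x _ rfl _ rfl z
    exact med_self _ _
  obtain ⟨C, hxC, hC⟩ := exists_maximal_isConvex_disjoint (hs x)
    (Set.disjoint_singleton.2 hxy)
  obtain ⟨D, hyD, hD⟩ := exists_maximal_isConvex_disjoint (hs y) hC.prop.2.symm
  -- joining `p` to `C` or to `D` must create an intersection with the other set
  have key : ∀ {C B : Set M} {p : M}, Maximal (fun C => IsConvex C ∧ Disjoint C B) C →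
      C.Nonempty → p ∉ C → ∃ c ∈ C, ∃ d ∈ B, Btw c d p := by
    intro C B p hC ⟨c₀, hc₀⟩ hp
    by_contra! hcon
    refine hp (hC.le_of_ge (y := {t | ∃ c ∈ C, Btw c t p}) ⟨hC.prop.1.join p, ?_⟩ ?_ ?_)
    · rw [Set.disjoint_left]
      rintro t ⟨c, hc, ht⟩ htB
      exact hcon c hc t htB ht
    · exact fun c hc => ⟨c, hc, med_self _ _⟩
    · exact ⟨c₀, hc₀, btw_refl _ _⟩
  have hCD : Cᶜ = D := by
    refine Set.Subset.antisymm (fun p hp => ?_) ?_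
    · by_contra hpD
      obtain ⟨c, hc, d, hd, h1⟩ := key hC ⟨x, hxC rfl⟩ hp
      obtain ⟨d', hd', c', hc', h2⟩ := key hD ⟨y, hyD rfl⟩ hpD
      obtain ⟨z, hz, hz'⟩ := pasch h1 h2
      have hzC : z ∈ C := by
        rw [← show med c z c' = z from hz]; exact hC.prop.1.med_mem₁₃ hc hc'
      have hzD : z ∈ D := by
        rw [← show med d z d' = z from hz']
        exact hD.prop.1.med_mem₁₃ (by rcases hd with rfl; exact hyD rfl) hd'
      exact Set.disjoint_left.1 hD.prop.2 hzD hzC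
    · exact fun p hp hpC => Set.disjoint_left.1 hD.prop.2 hp hpC
  exact ⟨C, ⟨hC.prop.1, hCD ▸ hD.prop.1⟩, hxC rfl, fun h =>
    Set.disjoint_left.1 hC.prop.2 h rfl⟩

theorem eq_of_forall_isBiconvex {x y : M} (h : ∀ s : Set M, IsBiconvex s → x ∈ s → y ∈ s) :
    x = y := by
  by_contra hxy
  obtain ⟨s, hs, hx, hy⟩ := exists_isBiconvex_mem_notMem hxy
  exact hy (h s hs hx)

/-- Helly's theorem: finitely many convex sets that meet pairwise have a common point. -/
theorem helly [Nonempty M] {ι : Type*} (s : Finset ι) (C : ι → Set M)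
    (hC : ∀ i ∈ s, IsConvex (C i)) (h : ∀ i ∈ s, ∀ j ∈ s, (C i ∩ C j).Nonempty) :
    ∃ x, ∀ i ∈ s, x ∈ C i := by
  classical
  induction s using Finset.induction_on generalizing C with
  | empty => exact ⟨Classical.arbitrary M, by simp⟩
  | insert a s ha ih =>
    rcases s.eq_empty_or_nonempty with rfl | ⟨i₀, hi₀⟩
    · obtain ⟨x, hx⟩ := h a (by simp) a (by simp)
      exact ⟨x, by simpa using hx.1⟩
    obtain ⟨x, hx⟩ := ih (fun i => C i ∩ C a)
      (fun i hi x hx y hy z => ⟨hC i (by simp [hi]) x hx.1 y hy.1 z,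
        hC a (by simp) x hx.2 y hy.2 z⟩) (by
        intro i hi j hj
        obtain ⟨u, hu, hu'⟩ := h i (by simp [hi]) j (by simp [hj])
        obtain ⟨v, hv, hv'⟩ := h i (by simp [hi]) a (by simp)
        obtain ⟨w, hw, hw'⟩ := h j (by simp [hj]) a (by simp)
        have ci := hC i (by simp [hi])
        have cj := hC j (by simp [hj])
        have ca := hC a (by simp)
        exact ⟨med u v w, ⟨ci u hu v hv w, ca.med_mem₂₃ hv' hw'⟩,
          ⟨cj.med_mem₁₃ hu' hw, ca.med_mem₂₃ hv' hw'⟩⟩)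
    refine ⟨x, fun i hi => ?_⟩
    rcases Finset.mem_insert.1 hi with rfl | hi
    · exact (hx i₀ hi₀).2
    · exact (hx i hi).1

/-! ### Transverse halfspaces and rank -/

/-- Two sets are transverse if all four of their sectors are nonempty. -/
def Transverse {α : Type*} (h k : Set α) : Prop :=
  (h ∩ k).Nonempty ∧ (h ∩ kᶜ).Nonempty ∧ (hᶜ ∩ k).Nonempty ∧ (hᶜ ∩ kᶜ).Nonempty

theorem Transverse.symm {α : Type*} {h k : Set α} (H : Transverse h k) : Transverse k h := by
  obtain ⟨h1, h2, h3, h4⟩ := H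
  rw [Set.inter_comm] at h1 h2 h3 h4
  exact ⟨h1, h3, h2, h4⟩

/-- Finite joins in the lattice `[a, b]`, described by their membership in biconvex sets. -/
theorem exists_join (a b : M) (T : Finset M) :
    ∃ p : M, ∀ h : Set M, IsBiconvex h → b ∈ h → (p ∈ h ↔ a ∈ h ∨ ∃ t ∈ T, t ∈ h) := by
  classical
  induction T using Finset.induction_on with
  | empty => exact ⟨a, fun h _ _ => by simp⟩
  | insert t T _ ih =>
    obtain ⟨p, hp⟩ := ih
    refine ⟨med b (med a b t) p, fun h hh hb => ?_⟩
    have := hp h hh hb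
    simp only [hh.med_mem, Finset.exists_mem_insert, this, hb, true_and, and_true]
    generalize (∃ t ∈ T, t ∈ h) = q
    tauto

/-- Finitely many pairwise transverse halfspaces give a cube: the map to `{0,1}^k` that they
define has a section, built from a Boolean sublattice of an interval `[a, b]`. -/
theorem containsCube_of_transverse [Nonempty M] {k : ℕ} (h : Fin k → Set M)
    (hh : ∀ i, IsHalfspace (h i)) (ht : Pairwise fun i j => Transverse (h i) (h j)) :
    ContainsCube M k := by
  classical
  -- all sectors of the family are inhabited
  have hx : ∀ ε : Fin k → Bool, ∃ x, ∀ i, x ∈ h i ↔ ε i = true := by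
    intro ε
    obtain ⟨x, hx⟩ := helly Finset.univ (fun i => if ε i then h i else (h i)ᶜ)
      (fun i _ => by
        split_ifs
        · exact (hh i).2.2.1
        · exact (hh i).2.2.2)
      (fun i _ j _ => by
        by_cases hij : i = j
        · subst hij
          split_ifs
          · simpa using (hh i).1
          · simpa using (hh i).2.1
        · obtain ⟨h1, h2, h3, h4⟩ := ht hij
          split_ifs <;> assumption)
    refine ⟨x, fun i => ?_⟩
    have := hx i (Finset.mem_univ _)
    cases hε : ε i <;> simpa [hε] using this
  choose x hx using hx
  set a := x fun _ => false with ha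
  set b := x fun _ => true with hb
  set e : Fin k → M := fun i => x fun j => decide (j = i) with he
  -- the bottom of the cube: above it, the points `e i` have pairwise trivial meets
  obtain ⟨a', ha'⟩ := exists_join a b
    ((Finset.univ.filter fun p : Fin k × Fin k => p.1 ≠ p.2).image
      fun p => med a (e p.1) (e p.2))
  have hF : ∀ ε : Fin k → Bool, ∃ p : M, ∀ s : Set M, IsBiconvex s → b ∈ s →
      (p ∈ s ↔ a' ∈ s ∨ ∃ i, ε i = true ∧ e i ∈ s) := by
    intro ε
    obtain ⟨p, hp⟩ := exists_join a' b ((Finset.univ.filter fun i => ε i = true).image e)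
    refine ⟨p, fun s hs hbs => ?_⟩
    rw [hp s hs hbs]
    simp
  choose F hF using hF
  have ha'i : ∀ i, a' ∉ h i := by
    intro i hi
    rw [ha' _ (hh i).isBiconvex (by simp [hb, hx])] at hi
    rcases hi with hi | ⟨t, htm, hi⟩
    · simp [ha, hx] at hi
    · obtain ⟨⟨j, l⟩, hjl, rfl⟩ := Finset.mem_image.1 htm
      simp only [(hh i).isBiconvex.med_mem, he, ha, hx] at hi
      simp only [Finset.mem_filter, Finset.mem_univ, true_and] at hjl
      simp at hi
      exact hjl (hi.1.symm.trans hi.2)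
  refine ⟨F, ?_, ?_⟩
  · have key : ∀ (ε δ γ : Fin k → Bool) (s : Set M), IsBiconvex s → b ∈ s →
        (F (med ε δ γ) ∈ s ↔ med (F ε) (F δ) (F γ) ∈ s) := by
      intro ε δ γ s hs hbs
      rw [hs.med_mem, hF _ s hs hbs, hF _ s hs hbs, hF _ s hs hbs, hF _ s hs hbs]
      by_cases has : a' ∈ s
      · simp [has]
      simp only [has, false_or]
      -- outside `a'`, the set `s` contains at most one of the points `e i`
      have huniq : ∀ i j, e i ∈ s → e j ∈ s → i = j := by
        intro i j hi hj
        by_contra hij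
        refine has ((ha' s hs hbs).2 (Or.inr ⟨med a (e i) (e j), ?_, hs.1.med_mem₂₃ hi hj⟩))
        exact Finset.mem_image.2 ⟨(i, j), by simpa using hij, rfl⟩
      by_cases hex : ∃ i, e i ∈ s
      · obtain ⟨i, hi⟩ := hex
        have hone : ∀ ε : Fin k → Bool, (∃ j, ε j = true ∧ e j ∈ s) ↔ ε i = true := by
          intro ε
          refine ⟨?_, fun h => ⟨i, h, hi⟩⟩
          rintro ⟨j, hj, hjs⟩
          rw [huniq i j hi hjs]; exact hj
        rw [hone, hone, hone, hone]
        change ((ε i && δ i) || (δ i && γ i) || (ε i && γ i)) = true ↔ _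
        simp only [Bool.or_eq_true, Bool.and_eq_true]
        tauto
      · push Not at hex
        simp [hex]
    intro ε δ γ
    refine eq_of_forall_isBiconvex fun s hs hm => ?_
    by_cases hbs : b ∈ s
    · exact (key ε δ γ s hs hbs).1 hm
    · by_contra hn
      exact (key ε δ γ sᶜ hs.compl hbs).2 hn hm
  · intro ε δ hεδ
    have hi : ∀ (ε : Fin k → Bool) i, F ε ∈ h i ↔ ε i = true := by
      intro ε i
      rw [hF ε _ (hh i).isBiconvex (by simp [hb, hx])]
      simp [ha'i, he, hx]
    funext i
    rw [Bool.eq_iff_iff, ← hi, ← hi, hεδ]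

theorem card_le_of_transverse [Nonempty M] {r : ℕ} (hr : rank M = r) (s : Finset (Set M))
    (hs : ∀ h ∈ s, IsHalfspace h) (ht : (s : Set (Set M)).Pairwise Transverse) : s.card ≤ r := by
  have h1 : ContainsCube M s.card :=
    containsCube_of_transverse (fun i => (s.equivFin.symm i : Set M)) (fun i => hs _ (by simp))
      (fun i j hij => ht (by simp) (by simp) (by
        intro h
        exact hij (s.equivFin.symm.injective (Subtype.ext h))))
  have h2 : (s.card : ℕ∞) ≤ rank M := le_iSup₂_of_le s.card h1 le_rfl
  rw [hr] at h2
  exact_mod_cast h2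

theorem finite_of_transverse [Nonempty M] {r : ℕ} (hr : rank M = r) (s : Set (Set M))
    (hs : ∀ h ∈ s, IsHalfspace h) (ht : s.Pairwise Transverse) : s.Finite := by
  by_contra hinf
  obtain ⟨t, hts, htc⟩ := Set.Infinite.exists_subset_card_eq hinf (r + 1)
  have := card_le_of_transverse hr t (fun h hh => hs h (hts hh)) (ht.mono hts)
  omega

/-! ### Common points of families of biconvex sets -/

/-- A chain of sets whose intersection misses a finite set has a member missing it. -/
theorem exists_mem_chain_disjoint {α : Type*} {𝒞 : Set (Set α)} (hc : IsChain (· ⊆ ·) 𝒞)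
    (hne : 𝒞.Nonempty) {P : Set α} (hP : P.Finite) (h : ∀ p ∈ P, p ∉ ⋂₀ 𝒞) :
    ∃ C ∈ 𝒞, ∀ p ∈ P, p ∉ C := by
  induction P, hP using Set.Finite.induction_on with
  | empty => exact ⟨hne.some, hne.some_mem, by simp⟩
  | @insert a P _ _ ih =>
    obtain ⟨C, hC, hCP⟩ := ih fun p hp => h p (Or.inr hp)
    have ha := h a (Or.inl rfl)
    simp only [Set.mem_sInter, not_forall] at ha
    obtain ⟨D, hD, haD⟩ := ha
    rcases hc.total hC hD with hCD | hCD
    · exact ⟨C, hC, by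
        rintro p (rfl | hp)
        · exact fun hp => haD (hCD hp)
        · exact hCP p hp⟩
    · exact ⟨D, hD, by
        rintro p (rfl | hp)
        · exact haD
        · exact fun hpD => hCP p hp (hCD hpD)⟩

/-- In finite rank, a family of pairwise intersecting biconvex sets that is closed under
intersections of chains has a common point. -/
theorem exists_forall_mem [Nonempty M] {r : ℕ} (hr : rank M = r) (F : Set (Set M))
    (hF : ∀ h ∈ F, IsBiconvex h) (hint : ∀ h ∈ F, ∀ k ∈ F, (h ∩ k).Nonempty)
    (hchain : ∀ 𝒞 ⊆ F, IsChain (· ⊆ ·) 𝒞 → 𝒞.Nonempty → ⋂₀ 𝒞 ∈ F) :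
    ∃ x, ∀ h ∈ F, x ∈ h := by
  have hmin : ∀ h ∈ F, ∃ k ⊆ h, Minimal (· ∈ F) k := fun h hh =>
    zorn_superset_nonempty F (fun 𝒞 h𝒞 hc hne =>
      ⟨⋂₀ 𝒞, hchain 𝒞 h𝒞 hc hne, fun C hC => Set.sInter_subset_of_mem hC⟩) h hh
  set A : M → Set (Set M) := fun x => {h | Minimal (· ∈ F) h ∧ x ∉ h} with hA
  have hAfin : ∀ x, (A x).Finite := by
    intro x
    refine finite_of_transverse hr _ ?_ ?_
    · rintro h ⟨hh, hx⟩
      obtain ⟨y, hy, _⟩ := hint h hh.prop h hh.prop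
      exact (hF h hh.prop).isHalfspace hy hx
    · rintro h ⟨hh, hx⟩ k ⟨hk, hx'⟩ hne
      refine ⟨hint h hh.prop k hk.prop, ?_, ?_, ⟨x, hx, hx'⟩⟩
      · rw [Set.inter_compl_nonempty_iff]
        exact fun hsub => hne (hk.eq_of_subset hh.prop hsub)
      · rw [Set.inter_comm, Set.inter_compl_nonempty_iff]
        exact fun hsub => hne (hh.eq_of_subset hk.prop hsub).symm
  have hcommon : ∀ s : Set (Set M), s.Finite → s ⊆ F → ∃ x, ∀ h ∈ s, x ∈ h := by
    intro s hs hsF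
    obtain ⟨x, hx⟩ := helly hs.toFinset id
      (fun h hh => (hF h (hsF (by simpa using hh))).1)
      (fun h hh k hk => hint h (hsF (by simpa using hh)) k (hsF (by simpa using hk)))
    exact ⟨x, fun h hh => hx h (by simpa using hh)⟩
  -- three points such that every minimal member misses at most one of them
  let x₀ : M := Classical.arbitrary M
  obtain ⟨x₁, h₁⟩ := hcommon (A x₀) (hAfin _) fun h hh => hh.1.prop
  obtain ⟨x₂, h₂⟩ := hcommon (A x₀ ∪ A x₁) ((hAfin _).union (hAfin _)) (by
    rintro h (hh | hh) <;> exact hh.1.prop)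
  refine ⟨med x₀ x₁ x₂, fun h hh => ?_⟩
  obtain ⟨k, hkh, hk⟩ := hmin h hh
  refine hkh ?_
  rw [(hF k hk.prop).med_mem]
  by_cases hk0 : x₀ ∈ k
  · by_cases hk1 : x₁ ∈ k
    · exact Or.inl ⟨hk0, hk1⟩
    · exact Or.inr (Or.inr ⟨hk0, h₂ k (Or.inr ⟨hk, hk1⟩)⟩)
  · exact Or.inr (Or.inl ⟨h₁ k ⟨hk, hk0⟩, h₂ k (Or.inl ⟨hk, hk0⟩)⟩)

open scoped Pointwise

/-! ### Translates of halfspaces -/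

theorem smul_med (g : Aut M) (x y z : M) : g • med x y z = med (g • x) (g • y) (g • z) :=
  g.2 x y z

theorem IsConvex.smul {C : Set M} (hC : IsConvex C) (g : Aut M) : IsConvex (g • C) := by
  intro x hx y hy z
  rw [Set.mem_smul_set_iff_inv_smul_mem] at *
  rw [smul_med]
  exact hC _ hx _ hy _

theorem IsBiconvex.smul {h : Set M} (hh : IsBiconvex h) (g : Aut M) : IsBiconvex (g • h) :=
  ⟨hh.1.smul g, by rw [← Set.smul_set_compl]; exact hh.2.smul g⟩

theorem IsHalfspace.smul {h : Set M} (hh : IsHalfspace h) (g : Aut M) : IsHalfspace (g • h) :=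
  ⟨hh.1.smul_set, by rw [← Set.smul_set_compl]; exact hh.2.1.smul_set, hh.isBiconvex.smul g⟩

theorem Transverse.smul {h k : Set M} (H : Transverse h k) (g : Aut M) :
    Transverse (g • h) (g • k) := by
  obtain ⟨h1, h2, h3, h4⟩ := H
  simp only [Transverse, ← Set.smul_set_compl, ← Set.smul_set_inter]
  exact ⟨h1.smul_set, h2.smul_set, h3.smul_set, h4.smul_set⟩

theorem smul_pow_subset {g : Aut M} {h : Set M} (hg : g • h ⊆ h) (n : ℕ) : g ^ n • h ⊆ h := by
  induction n with
  | zero => simp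
  | succ n ih =>
    rw [pow_succ, mul_smul]
    exact (Set.smul_set_mono hg).trans ih

theorem subset_smul_pow {g : Aut M} {h : Set M} (hg : h ⊆ g • h) (n : ℕ) : h ⊆ g ^ n • h := by
  induction n with
  | zero => simp
  | succ n ih =>
    rw [pow_succ, mul_smul]
    exact ih.trans (Set.smul_set_mono hg)

theorem smul_zpow_eq {G α : Type*} [Group G] [MulAction G α] {g : G} {a : α} (hg : g • a = a)
    (n : ℤ) : g ^ n • a = a :=
  MulAction.mem_stabilizer_iff.1 (zpow_mem (MulAction.mem_stabilizer_iff.2 hg) n)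

theorem smul_pow_eq {G α : Type*} [Group G] [MulAction G α] {g : G} {a : α} (hg : g • a = a)
    (n : ℕ) : g ^ n • a = a := by
  rw [← zpow_natCast]; exact smul_zpow_eq hg n

/-- In rank `r`, a halfspace is not transverse to all of its first `r` translates. -/
theorem exists_not_transverse [Nonempty M] {r : ℕ} (hr : rank M = r) (g : Aut M) {h : Set M}
    (hh : IsHalfspace h) : ∃ n, 1 ≤ n ∧ n ≤ r ∧
      (Disjoint h (g ^ n • h) ∨ h ∪ g ^ n • h = Set.univ ∨ g ^ n • h ⊆ h ∨ h ⊆ g ^ n • h) := by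
  classical
  by_contra! hcon
  have ht : ∀ n, 1 ≤ n → n ≤ r → Transverse h (g ^ n • h) := by
    intro n hn hn'
    obtain ⟨h1, h2, h3, h4⟩ := hcon n hn hn'
    refine ⟨Set.not_disjoint_iff_nonempty_inter.1 h1, Set.inter_compl_nonempty_iff.2 h4, ?_, ?_⟩
    · rw [Set.inter_comm]; exact Set.inter_compl_nonempty_iff.2 h3
    · rw [← Set.compl_union, Set.nonempty_compl]; exact h2
  have htr : ∀ i j : ℕ, i < j → j ≤ r → Transverse (g ^ i • h) (g ^ j • h) := by
    intro i j hij hj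
    have := (ht (j - i) (by omega) (by omega)).smul (g ^ i)
    rwa [← mul_smul, ← pow_add, Nat.add_sub_cancel' hij.le] at this
  have hself : ∀ k : Set M, ¬ Transverse k k := fun k hk => by simpa using hk.2.1
  have hcard := card_le_of_transverse hr ((Finset.range (r + 1)).image fun i => g ^ i • h)
    (by
      intro k hk
      obtain ⟨i, _, rfl⟩ := Finset.mem_image.1 hk
      exact hh.smul _)
    (by
      intro k hk l hl hkl
      obtain ⟨i, hi, rfl⟩ := Finset.mem_image.1 hk
      obtain ⟨j, hj, rfl⟩ := Finset.mem_image.1 hl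
      rw [Finset.mem_range] at hi hj
      rcases lt_trichotomy i j with hij | rfl | hij
      · exact htr i j hij (by omega)
      · exact absurd rfl hkl
      · exact (htr j i hij (by omega)).symm)
  rw [Finset.card_image_of_injOn, Finset.card_range] at hcard
  · omega
  · intro i hi j hj hij
    simp only [Finset.coe_range, Set.mem_Iio] at hi hj
    simp only at hij
    by_contra hne
    rcases lt_or_gt_of_ne hne with hlt | hlt
    · have := htr i j hlt (by omega)
      rw [hij] at this
      exact hself _ this
    · have := htr j i hlt (by omega)
      rw [hij] at this
      exact hself _ this

/-! ### A point in the core -/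

theorem StablyWithoutWallInversions.smul_ne_compl {g : Aut M}
    (hg : StablyWithoutWallInversions g) {h : Set M} (hh : IsHalfspace h) (n : ℤ) :
    g ^ n • h ≠ hᶜ := fun heq =>
  hg ⟨h, ⟨g ^ n, n, rfl⟩, hh, heq⟩

/-- If `h` is a set that covers `M` together with a translate, and likewise `k`, then `h`
meets `k`, because otherwise the wall of `k` is inverted. -/
theorem StablyWithoutWallInversions.inter_nonempty [Nonempty M] {g : Aut M}
    (hg : StablyWithoutWallInversions g) {h k : Set M} (hk : IsBiconvex k) {m n : ℤ}
    (hn : h ∪ g ^ n • h = Set.univ) (hm : k ∪ g ^ m • k = Set.univ) : (h ∩ k).Nonempty := by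
  by_contra hcon
  rw [Set.not_nonempty_iff_eq_empty, ← Set.disjoint_iff_inter_eq_empty] at hcon
  have hkh : k ⊆ hᶜ := hcon.subset_compl_left
  have h1 : hᶜ ⊆ g ^ n • h := by
    rw [Set.compl_subset_iff_union]; exact hn
  have h2 : g ^ n • k ⊆ kᶜ := by
    have := Set.smul_set_mono (a := g ^ n) hkh
    rw [Set.smul_set_compl] at this
    exact (this.trans (Set.compl_subset_comm.1 h1)).trans hcon.subset_compl_right
  have h3 : kᶜ ⊆ g ^ m • k := by
    rw [Set.compl_subset_iff_union]; exact hm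
  have h2' : g ^ n • kᶜ ⊇ k := by
    rw [Set.smul_set_compl]; exact Set.subset_compl_comm.1 h2
  have h4 : g ^ (n - m) • k ⊆ k := by
    have := Set.smul_set_mono (a := g ^ (-m)) (h2.trans h3)
    rwa [← mul_smul, ← mul_smul, ← zpow_add, ← zpow_add, neg_add_cancel, zpow_zero, one_smul,
      neg_add_eq_sub] at this
  have h3' : kᶜ ⊆ g ^ (-m) • k := by
    have := Set.smul_set_mono (a := g ^ (-m)) (Set.compl_subset_comm.1 h3)
    rwa [← Set.smul_set_compl, ← mul_smul, ← zpow_add, neg_add_cancel, zpow_zero, one_smul] at this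
  have h5 : g ^ n • kᶜ ⊆ g ^ (n - m) • k := by
    have := Set.smul_set_mono (a := g ^ n) h3'
    rwa [← mul_smul, ← zpow_add, ← sub_eq_add_neg] at this
  have h6 : g ^ n • k = kᶜ := by
    rw [← compl_inj_iff, compl_compl, ← Set.smul_set_compl]
    exact Set.Subset.antisymm (h5.trans h4) h2'
  obtain ⟨y, hy⟩ : k.Nonempty := by
    rw [Set.nonempty_iff_ne_empty]
    rintro rfl
    simp [Set.empty_ne_univ] at hm
  exact hg.smul_ne_compl (hk.isHalfspace hy (h2 (Set.smul_mem_smul_set hy))) n h6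

/-- Some point has its whole orbit in every biconvex set that covers `M` together with one of
its first `N` translates. -/
theorem StablyWithoutWallInversions.exists_mem_core [Nonempty M] {r : ℕ} (hr : rank M = r)
    {g : Aut M} (hg : StablyWithoutWallInversions g) (N : ℕ) :
    ∃ x : M, ∀ h : Set M, IsBiconvex h → ∀ n : ℕ, 1 ≤ n → n ≤ N → h ∪ g ^ n • h = Set.univ →
      ∀ k : ℤ, g ^ k • x ∈ h := by
  obtain ⟨x, hx⟩ := exists_forall_mem hr
    {h | IsBiconvex h ∧ ∃ n : ℕ, 1 ≤ n ∧ n ≤ N ∧ h ∪ g ^ n • h = Set.univ}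
    (fun h hh => hh.1)
    (by
      rintro h ⟨hh, n, -, -, hn⟩ k ⟨hk, m, -, -, hm⟩
      exact hg.inter_nonempty hk (n := n) (m := m) (by simpa using hn) (by simpa using hm))
    (by
      intro 𝒞 h𝒞 hc hne
      refine ⟨isBiconvex_sInter_of_isChain hc fun C hC => (h𝒞 hC).1, ?_⟩
      by_contra! hcon
      -- for each `n`, a point outside the intersection and outside its translate by `g ^ n`
      have hp : ∀ n : ℕ, ∃ p : M, 1 ≤ n → n ≤ N →
          p ∉ ⋂₀ 𝒞 ∧ (g ^ n)⁻¹ • p ∉ ⋂₀ 𝒞 := by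
        intro n
        by_cases hn : 1 ≤ n ∧ n ≤ N
        · obtain ⟨p, hp⟩ := (Set.ne_univ_iff_exists_notMem _).1 (hcon n hn.1 hn.2)
          refine ⟨p, fun _ _ => ?_⟩
          rw [Set.mem_union, not_or, Set.mem_smul_set_iff_inv_smul_mem] at hp
          exact hp
        · exact ⟨Classical.arbitrary M, fun h1 h2 => absurd ⟨h1, h2⟩ hn⟩
      choose p hp using hp
      obtain ⟨C, hC, hCp⟩ := exists_mem_chain_disjoint hc hne
        (P := p '' Set.Icc 1 N ∪ (fun n => (g ^ n)⁻¹ • p n) '' Set.Icc 1 N)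
        (((Set.finite_Icc 1 N).image _).union ((Set.finite_Icc 1 N).image _))
        (by
          rintro q (⟨n, hn, rfl⟩ | ⟨n, hn, rfl⟩)
          · exact (hp n hn.1 hn.2).1
          · exact (hp n hn.1 hn.2).2)
      obtain ⟨-, n, hn, hn', hcov⟩ := h𝒞 hC
      have hmem : p n ∈ C ∪ g ^ n • C := hcov ▸ Set.mem_univ _
      rcases hmem with hm | hm
      · exact hCp _ (Or.inl ⟨n, ⟨hn, hn'⟩, rfl⟩) hm
      · exact hCp _ (Or.inr ⟨n, ⟨hn, hn'⟩, rfl⟩) (Set.mem_smul_set_iff_inv_smul_mem.1 hm))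
  refine ⟨x, fun h hh n hn hn' hcov k => ?_⟩
  have := hx (g ^ (-k) • h) ⟨hh.smul _, n, hn, hn', by
    have := congrArg (fun s => g ^ (-k) • s) hcov
    simp only [Set.smul_set_union, Set.smul_set_univ] at this
    rw [← mul_smul] at this ⊢
    rwa [← zpow_natCast, ← zpow_add, add_comm, zpow_add, zpow_natCast] at this⟩
  rwa [zpow_neg, Set.mem_inv_smul_set_iff] at this

/-! ### Removing periodic halfspaces -/

/-- The halfspaces that separate two points of the orbit of `x` under `g`. -/
def orbitHalfspaces (g : Aut M) (x : M) : Set (Set M) :=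
  {h | IsBiconvex h ∧ (∃ i : ℤ, g ^ i • x ∈ h) ∧ ∃ j : ℤ, g ^ j • x ∉ h}

theorem isHalfspace_of_mem_orbitHalfspaces {g : Aut M} {x : M} {h : Set M}
    (hh : h ∈ orbitHalfspaces g x) : IsHalfspace h := by
  obtain ⟨hb, ⟨i, hi⟩, j, hj⟩ := hh
  exact hb.isHalfspace hi hj

theorem compl_mem_orbitHalfspaces {g : Aut M} {x : M} {h : Set M}
    (hh : h ∈ orbitHalfspaces g x) : hᶜ ∈ orbitHalfspaces g x := by
  obtain ⟨hb, ⟨i, hi⟩, j, hj⟩ := hh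
  exact ⟨hb.compl, ⟨j, hj⟩, i, fun h => h hi⟩

theorem smul_mem_orbitHalfspaces {g : Aut M} {x : M} {h : Set M}
    (hh : h ∈ orbitHalfspaces g x) (k : ℤ) : g ^ k • h ∈ orbitHalfspaces g x := by
  obtain ⟨hb, ⟨i, hi⟩, j, hj⟩ := hh
  refine ⟨hb.smul _, ⟨k + i, ?_⟩, k + j, ?_⟩
  · rwa [zpow_add, mul_smul, Set.smul_mem_smul_set_iff]
  · rwa [zpow_add, mul_smul, Set.smul_mem_smul_set_iff]

theorem smul_zpow_emod {g : Aut M} {h : Set M} {N : ℕ} (hN : g ^ N • h = h) (k : ℤ) :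
    g ^ k • h = g ^ (k % N) • h := by
  conv_lhs => rw [← Int.emod_add_mul_ediv k N, zpow_add, zpow_mul, mul_smul, zpow_natCast,
    smul_zpow_eq hN]

/-- The `g ^ N`-periodic halfspaces separating points of an orbit contain a minimal one. -/
theorem exists_minimal_periodic {g : Aut M} {x : M} {N : ℕ} (hN : 1 ≤ N) {h : Set M}
    (hh : h ∈ orbitHalfspaces g x ∧ g ^ N • h = h) :
    ∃ k, Minimal (· ∈ {h | h ∈ orbitHalfspaces g x ∧ g ^ N • h = h}) k := by
  obtain ⟨k, -, hk⟩ := zorn_superset_nonempty {h | h ∈ orbitHalfspaces g x ∧ g ^ N • h = h}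
    (by
      intro 𝒞 h𝒞 hc hne
      refine ⟨⋂₀ 𝒞, ⟨⟨isBiconvex_sInter_of_isChain hc fun C hC => (h𝒞 hC).1.1, ?_, ?_⟩, ?_⟩,
        fun C hC => Set.sInter_subset_of_mem hC⟩
      · by_contra! hcon
        obtain ⟨C, hC, hCp⟩ := exists_mem_chain_disjoint hc hne
          (P := (fun i : ℤ => g ^ i • x) '' Set.Ico 0 N) ((Set.finite_Ico 0 _).image _)
          (by rintro _ ⟨i, -, rfl⟩; exact hcon i)
        obtain ⟨⟨-, ⟨i, hi⟩, -⟩, hper⟩ := h𝒞 hC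
        refine hCp (g ^ (i % N) • x) ⟨i % N, ⟨Int.emod_nonneg _ (by omega),
          Int.emod_lt_of_pos _ (by omega)⟩, rfl⟩ ?_
        rw [← Int.emod_add_mul_ediv i N, add_comm, zpow_add, zpow_mul, mul_smul, zpow_natCast]
          at hi
        have := smul_zpow_eq hper (i / N)
        rwa [← this, Set.smul_mem_smul_set_iff] at hi
      · obtain ⟨C, hC⟩ := hne
        obtain ⟨⟨-, -, j, hj⟩, -⟩ := h𝒞 hC
        exact ⟨j, fun hj' => hj (hj' C hC)⟩
      · ext y
        rw [Set.mem_smul_set_iff_inv_smul_mem]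
        simp only [Set.mem_sInter]
        refine forall₂_congr fun C hC => ?_
        rw [← Set.mem_smul_set_iff_inv_smul_mem, (h𝒞 hC).2])
    h hh
  exact ⟨k, hk⟩

/-- If every halfspace separating points of the orbit of `x` meets its first `N` translates, then
`x` can be moved, inside the hull of its orbit, so that no such halfspace is `g ^ N`-periodic:
a minimal periodic halfspace `h` is transverse to all that remain after moving into the
intersection of its translates. -/
theorem exists_no_periodic [Nonempty M] {r : ℕ} (hr : rank M = r) {g : Aut M} {N : ℕ}
    (hN : 1 ≤ N) (x : M)
    (hx : ∀ h ∈ orbitHalfspaces g x, ∀ n : ℕ, 1 ≤ n → n ≤ N → (h ∩ g ^ n • h).Nonempty) :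
    ∃ y, orbitHalfspaces g y ⊆ orbitHalfspaces g x ∧
      ∀ h ∈ orbitHalfspaces g y, g ^ N • h ≠ h := by
  classical
  have key : ∀ (n : ℕ) (x : M),
      (∀ h ∈ orbitHalfspaces g x, ∀ n : ℕ, 1 ≤ n → n ≤ N → (h ∩ g ^ n • h).Nonempty) →
      (∀ s : Finset (Set M), (∀ h ∈ s, h ∈ orbitHalfspaces g x ∧ g ^ N • h = h) →
        (s : Set (Set M)).Pairwise Transverse → s.card ≤ n) →
      ∃ y, orbitHalfspaces g y ⊆ orbitHalfspaces g x ∧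
        ∀ h ∈ orbitHalfspaces g y, g ^ N • h ≠ h := by
    intro n
    induction n with
    | zero =>
      intro x _ hcard
      refine ⟨x, subset_rfl, fun h hh hper => ?_⟩
      have := hcard {h} (by simpa using ⟨hh, hper⟩) (by simp)
      simp at this
    | succ n ih =>
      intro x hx hcard
      by_cases hex : ∃ h, h ∈ orbitHalfspaces g x ∧ g ^ N • h = h
      swap
      · push Not at hex
        exact ⟨x, subset_rfl, hex⟩
      obtain ⟨h₀, hh₀⟩ := hex
      obtain ⟨h, hmin⟩ := exists_minimal_periodic hN hh₀
      obtain ⟨hh, hper⟩ := hmin.prop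
      set K : Set M := ⋂₀ {k | IsBiconvex k ∧ ∀ i : ℤ, g ^ i • x ∈ k} with hK
      have hxK : ∀ i : ℤ, g ^ i • x ∈ K := fun i k hk => hk.2 i
      have hKh : ∀ k : ℕ, (K ∩ g ^ k • h).Nonempty := by
        intro k
        obtain ⟨-, ⟨i, hi⟩, -⟩ := smul_mem_orbitHalfspaces hh k
        rw [zpow_natCast] at hi
        exact ⟨_, hxK i, hi⟩
      have hlt : ∀ i j : ℕ, i < j → j < N → (g ^ i • h ∩ g ^ j • h).Nonempty := by
        intro i j hij hj
        have := (hx h hh (j - i) (by omega) (by omega)).smul_set (a := g ^ i)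
        rwa [Set.smul_set_inter, ← mul_smul, ← pow_add, Nat.add_sub_cancel' hij.le] at this
      obtain ⟨y, hy⟩ := helly (insert K ((Finset.range N).image fun k => g ^ k • h)) id
        (by
          intro k hk
          rcases Finset.mem_insert.1 hk with rfl | hk
          · exact isConvex_sInter fun k hk => hk.1.1
          · obtain ⟨i, _, rfl⟩ := Finset.mem_image.1 hk
            exact hh.1.1.smul _)
        (by
          intro k hk l hl
          rcases Finset.mem_insert.1 hk with rfl | hk
          · rcases Finset.mem_insert.1 hl with rfl | hl
            · exact ⟨_, hxK 0, hxK 0⟩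
            · obtain ⟨i, _, rfl⟩ := Finset.mem_image.1 hl
              exact hKh i
          · obtain ⟨i, hi, rfl⟩ := Finset.mem_image.1 hk
            rw [Finset.mem_range] at hi
            rcases Finset.mem_insert.1 hl with rfl | hl
            · rw [Set.inter_comm]; exact hKh i
            · obtain ⟨j, hj, rfl⟩ := Finset.mem_image.1 hl
              rw [Finset.mem_range] at hj
              rcases lt_trichotomy i j with hij | rfl | hij
              · exact hlt i j hij hj
              · obtain ⟨z, _, hz⟩ := hKh i
                exact ⟨z, hz, hz⟩
              · have := hlt j i hij hi
                rwa [Set.inter_comm] at this)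
      have hyK : y ∈ K := hy K (Finset.mem_insert_self _ _)
      have hyh : ∀ i : ℤ, g ^ i • y ∈ h := by
        intro i
        have h0 : 0 ≤ (-i) % (N : ℤ) := Int.emod_nonneg _ (by omega)
        have h1 : (-i) % (N : ℤ) < N := Int.emod_lt_of_pos _ (by omega)
        have := hy (g ^ ((-i) % (N : ℤ)).toNat • h)
          (Finset.mem_insert_of_mem (Finset.mem_image_of_mem _ (Finset.mem_range.2 (by omega))))
        rw [id, ← zpow_natCast, Int.toNat_of_nonneg h0, ← smul_zpow_emod hper, zpow_neg,
          Set.mem_inv_smul_set_iff] at this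
        exact this
      have hsub : orbitHalfspaces g y ⊆ orbitHalfspaces g x := by
        have haux : ∀ k, IsBiconvex k → (∀ i : ℤ, g ^ i • x ∈ k) → ∀ i : ℤ, g ^ i • y ∈ k := by
          intro k hk hxk i
          have := hyK (g ^ (-i) • k) ⟨hk.smul _, fun j => by
            rw [zpow_neg, Set.mem_inv_smul_set_iff, ← mul_smul, ← zpow_add]
            exact hxk _⟩
          rwa [zpow_neg, Set.mem_inv_smul_set_iff] at this
        rintro k ⟨hk, ⟨i, hi⟩, j, hj⟩
        refine ⟨hk, ?_, ?_⟩
        · by_contra! hcon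
          exact haux kᶜ hk.compl hcon i hi
        · by_contra! hcon
          exact hj (haux k hk hcon j)
      obtain ⟨z, hz, hz'⟩ := ih y (fun k hk => hx k (hsub hk)) (by
        intro s hs hst
        have htr : ∀ k ∈ s, Transverse h k := by
          intro k hk
          obtain ⟨hk', hkper⟩ := hs k hk
          have hnsub : ∀ k ∈ orbitHalfspaces g y, g ^ N • k = k → (hᶜ ∩ k).Nonempty := by
            intro k hk' hkper
            rw [Set.inter_comm, Set.inter_compl_nonempty_iff]
            intro hkh
            have : k = h := hmin.eq_of_subset ⟨hsub hk', hkper⟩ hkh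
            obtain ⟨-, -, j, hj⟩ := hk'
            exact hj (this.symm.subset (hyh j))
          have hnsub' := hnsub _ (compl_mem_orbitHalfspaces hk')
            (by rw [Set.smul_set_compl, hkper])
          have hnsub := hnsub k hk' hkper
          obtain ⟨-, ⟨i, hi⟩, j, hj⟩ := hk'
          exact ⟨⟨_, hyh i, hi⟩, ⟨_, hyh j, hj⟩, hnsub, hnsub'⟩
        have hhs : h ∉ s := fun hmem => by simpa using (htr h hmem).2.1
        have := hcard (insert h s)
          (by
            intro k hk
            rcases Finset.mem_insert.1 hk with rfl | hk
            · exact ⟨hh, hper⟩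
            · exact ⟨hsub (hs k hk).1, (hs k hk).2⟩)
          (by
            rw [Finset.coe_insert]
            exact hst.insert fun k hk _ => ⟨htr k hk, (htr k hk).symm⟩)
        rw [Finset.card_insert_of_notMem hhs] at this
        omega)
      exact ⟨z, hz.trans hsub, hz'⟩
  exact key r x hx fun s hs hst => card_le_of_transverse hr s
    (fun h hh => isHalfspace_of_mem_orbitHalfspaces (hs h hh).1) hst

/-! ### Uniform bounds -/

theorem zpow_smul_mem {g : Aut M} {N : ℕ} {h : Set M} (hN : g ^ N • h ⊆ h) {y : M} (hy : y ∈ h)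
    (m : ℕ) : g ^ (N * m : ℤ) • y ∈ h := by
  have := smul_pow_subset hN m (Set.smul_mem_smul_set hy)
  rw [← pow_mul] at this
  exact_mod_cast this

/-- The halfspaces separating points of the orbit of `x` that `g ^ N` maps into themselves. -/
def descending (g : Aut M) (N : ℕ) (x : M) : Set (Set M) :=
  {h | h ∈ orbitHalfspaces g x ∧ g ^ N • h ⊆ h}

theorem smul_mem_descending {g : Aut M} {N : ℕ} {x : M} {h : Set M}
    (hh : h ∈ descending g N x) (k : ℤ) : g ^ k • h ∈ descending g N x := by
  refine ⟨smul_mem_orbitHalfspaces hh.1 k, ?_⟩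
  have := Set.smul_set_mono (a := g ^ k) hh.2
  rwa [← mul_smul, ← zpow_natCast, ← zpow_add, add_comm, zpow_add, zpow_natCast, mul_smul] at this

/-- A descending halfspace containing `x` also contains a point `g ^ (ρ + N * L) • x`, where `L`
does not depend on the halfspace. Otherwise, the union of the translates under negative powers of
`g ^ N` of a limit of counterexamples along an ultrafilter is a `g ^ N`-periodic halfspace. -/
theorem exists_shift_mem {g : Aut M} {N : ℕ} {x : M}
    (hx : ∀ h ∈ orbitHalfspaces g x, g ^ N • h ≠ h) (ρ : ℤ) :
    ∃ L : ℕ, ∀ h ∈ descending g N x, x ∈ h → g ^ (ρ + N * L) • x ∈ h := by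
  by_contra! hcon
  choose h hh hxh hρ using hcon
  let U : Ultrafilter ℕ := Filter.hyperfilter ℕ
  let k : Set M := {y | ∃ m : ℕ, ∀ᶠ L in (U : Filter ℕ), g ^ (N * m : ℤ) • y ∈ h L}
  have hmono : ∀ {y : M} {m m' : ℕ}, m ≤ m' →
      (∀ᶠ L in (U : Filter ℕ), g ^ (N * m : ℤ) • y ∈ h L) →
      ∀ᶠ L in (U : Filter ℕ), g ^ (N * m' : ℤ) • y ∈ h L := by
    intro y m m' hm hy
    filter_upwards [hy] with L hL
    have := zpow_smul_mem (hh L).2 hL (m' - m)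
    rw [← mul_smul, ← zpow_add] at this
    convert this using 3
    push_cast [hm]
    ring
  have hkb : IsBiconvex k := by
    refine ⟨?_, ?_⟩
    · rintro y ⟨m, hm⟩ z ⟨m', hm'⟩ w
      refine ⟨max m m', ?_⟩
      filter_upwards [hmono (le_max_left m m') hm, hmono (le_max_right m m') hm'] with L h1 h2
      rw [smul_med]
      exact (hh L).1.1.1 _ h1 _ h2 _
    · rintro y hy z hz w ⟨m, hm⟩
      have hy' : ¬ ∀ᶠ L in (U : Filter ℕ), g ^ (N * m : ℤ) • y ∈ h L := fun h' => hy ⟨m, h'⟩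
      have hz' : ¬ ∀ᶠ L in (U : Filter ℕ), g ^ (N * m : ℤ) • z ∈ h L := fun h' => hz ⟨m, h'⟩
      rw [← Ultrafilter.eventually_not] at hy' hz'
      obtain ⟨L, h1, h2, h3⟩ := (hm.and (hy'.and hz')).exists
      rw [smul_med] at h1
      exact (hh L).1.1.2 _ h2 _ h3 _ h1
  have hxk : x ∈ k := ⟨0, Filter.Eventually.of_forall fun L => by simpa using hxh L⟩
  have hρk : g ^ ρ • x ∉ k := by
    rintro ⟨m, hm⟩
    have hge : ∀ᶠ L in (U : Filter ℕ), m ≤ L :=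
      Filter.Eventually.filter_mono
        (Nat.cofinite_eq_atTop ▸ Filter.hyperfilter_le_cofinite) (Filter.eventually_ge_atTop m)
    obtain ⟨L, h1, h2⟩ := (hm.and hge).exists
    refine hρ L ?_
    have := zpow_smul_mem (hh L).2 h1 (L - m)
    rw [← mul_smul, ← mul_smul, ← zpow_add, ← zpow_add] at this
    convert this using 3
    push_cast [h2]
    ring
  refine hx k ⟨hkb, ⟨0, by simpa using hxk⟩, ρ, hρk⟩ ?_
  ext y
  rw [Set.mem_smul_set_iff_inv_smul_mem]
  constructor
  · rintro ⟨m, hm⟩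
    refine ⟨m, ?_⟩
    filter_upwards [hm] with L hL
    have := zpow_smul_mem (hh L).2 hL 1
    rw [← mul_smul, ← mul_smul, ← zpow_natCast, ← zpow_neg, ← zpow_add, ← zpow_add] at this
    convert this using 3
    push_cast
    ring
  · rintro ⟨m, hm⟩
    refine ⟨m + 1, ?_⟩
    filter_upwards [hm] with L hL
    rw [← mul_smul, ← zpow_natCast, ← zpow_neg, ← zpow_add]
    convert hL using 3
    push_cast
    ring

/-- There is a uniform `L` such that the orbit of `x` stays in every descending halfspace from
`L` steps after any visit on. -/
theorem exists_uniform_bound {g : Aut M} {N : ℕ} (hN : 1 ≤ N) {x : M}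
    (hx : ∀ h ∈ orbitHalfspaces g x, g ^ N • h ≠ h) :
    ∃ L : ℕ, ∀ h ∈ descending g N x, ∀ i j : ℤ, i + L ≤ j → g ^ i • x ∈ h → g ^ j • x ∈ h := by
  choose L hL using fun ρ : ℕ => exists_shift_mem hx (ρ : ℤ)
  set B := (Finset.range N).sup L with hB
  refine ⟨N * B, fun h hh i j hij hi => ?_⟩
  set d := j - i with hd
  have hN' : (0 : ℤ) < N := by omega
  have h0 : 0 ≤ d % N := Int.emod_nonneg _ hN'.ne'
  have h1 : d % N < N := Int.emod_lt_of_pos _ hN'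
  obtain ⟨ρ, hρ⟩ := Int.eq_ofNat_of_zero_le h0
  have hq : (B : ℤ) ≤ d / N := by
    rw [Int.le_ediv_iff_mul_le hN']
    push_cast at hij
    linarith
  have hLB : L ρ ≤ B := Finset.le_sup (f := L) (Finset.mem_range.2 (by omega))
  have h2 := hL ρ _ (smul_mem_descending hh (-i)) (by rwa [zpow_neg, Set.mem_inv_smul_set_iff])
  have h3 := zpow_smul_mem (smul_mem_descending hh (-i)).2 h2 (d / N - L ρ).toNat
  rw [zpow_neg, Set.mem_inv_smul_set_iff, ← mul_smul, ← mul_smul, ← zpow_add, ← zpow_add] at h3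
  convert h3 using 3
  rw [Int.toNat_of_nonneg (by omega), ← hρ]
  have := Int.emod_add_mul_ediv d N
  linarith

/-! ### Majority votes along an orbit -/

/-- Twice the number of `i < W` for which `g ^ (k + i) • x` lies in `h`, where `g ^ k • x` counts
once more. The total number of votes is `2 * W + 1`, so that there are no ties. -/
noncomputable def votes (g : Aut M) (x : M) (W : ℕ) (h : Set M) (k : ℤ) : ℕ :=
  2 * (∑ i ∈ Finset.range W, h.indicator 1 (g ^ (k + i) • x)) + h.indicator 1 (g ^ k • x)

theorem votes_smul (g : Aut M) (x : M) (W : ℕ) (h : Set M) (k : ℤ) :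
    votes g x W (g ^ (-k) • h) 0 = votes g x W h k := by
  have aux : ∀ i : ℤ, (g ^ (-k) • h).indicator (1 : M → ℕ) (g ^ i • x) =
      h.indicator 1 (g ^ (k + i) • x) := by
    classical
    intro i
    simp only [Set.indicator_apply, zpow_neg, Set.mem_inv_smul_set_iff, ← mul_smul, ← zpow_add]
    rfl
  simp only [votes, aux, zero_add, add_zero]

theorem votes_compl (g : Aut M) (x : M) (W : ℕ) (h : Set M) (k : ℤ) :
    votes g x W h k + votes g x W hᶜ k = 2 * W + 1 := by
  have h1 : ∀ y : M, h.indicator (1 : M → ℕ) y + hᶜ.indicator (1 : M → ℕ) y = 1 :=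
    Set.indicator_self_add_compl_apply h 1
  have h2 : (∑ i ∈ Finset.range W, h.indicator (1 : M → ℕ) (g ^ (k + i : ℤ) • x)) +
      (∑ i ∈ Finset.range W, hᶜ.indicator (1 : M → ℕ) (g ^ (k + i : ℤ) • x)) = W := by
    rw [← Finset.sum_add_distrib, Finset.sum_congr rfl fun i _ => h1 _]
    simp
  have h3 := h1 (g ^ k • x)
  simp only [votes]
  omega

theorem votes_mono (g : Aut M) (x : M) (W : ℕ) {h h' : Set M} (k : ℤ)
    (H : ∀ i : ℕ, i ≤ W → g ^ (k + i) • x ∈ h → g ^ (k + i) • x ∈ h') :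
    votes g x W h k ≤ votes g x W h' k := by
  have aux : ∀ y : M, (y ∈ h → y ∈ h') → h.indicator (1 : M → ℕ) y ≤ h'.indicator 1 y := by
    intro y hy
    by_cases hyh : y ∈ h
    · simp [hyh, hy hyh]
    · simp [hyh]
  refine add_le_add (Nat.mul_le_mul_left 2 (Finset.sum_le_sum fun i hi => ?_)) ?_
  · exact aux _ (H i (Finset.mem_range.1 hi).le)
  · refine aux _ ?_
    simpa using H 0 (Nat.zero_le _)

/-- In finite rank, the majority vote along a segment of an orbit is realised by a point. -/
theorem exists_majority [Nonempty M] {r : ℕ} (hr : rank M = r) (g : Aut M) (x : M) (W : ℕ) :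
    ∃ y : M, ∀ h, IsBiconvex h → ∀ k : ℤ, g ^ k • y ∈ h ↔ W < votes g x W h k := by
  obtain ⟨y, hy⟩ := exists_forall_mem hr {h | IsBiconvex h ∧ W < votes g x W h 0}
    (fun h hh => hh.1)
    (by
      rintro h ⟨hh, hv⟩ k ⟨hk, hv'⟩
      by_contra hcon
      rw [Set.not_nonempty_iff_eq_empty, ← Set.disjoint_iff_inter_eq_empty] at hcon
      have h1 := votes_mono g x W (h := h) (h' := kᶜ) 0 fun i _ hi => hcon.subset_compl_right hi
      have h2 := votes_compl g x W k 0
      omega)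
    (by
      intro 𝒞 h𝒞 hc hne
      refine ⟨isBiconvex_sInter_of_isChain hc fun C hC => (h𝒞 hC).1, ?_⟩
      obtain ⟨C, hC, hCp⟩ := exists_mem_chain_disjoint hc hne
        (P := {p | p ∉ ⋂₀ 𝒞 ∧ p ∈ (fun i : ℕ => g ^ (0 + i : ℤ) • x) '' Set.Iic W})
        (((Set.finite_Iic W).image _).subset fun p hp => hp.2) (fun p hp => hp.1)
      refine (h𝒞 hC).2.trans_le (votes_mono g x W 0 fun i hi hiC => ?_)
      by_contra hn
      exact hCp _ ⟨hn, i, hi, rfl⟩ hiC)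
  have h0 : ∀ h, IsBiconvex h → (y ∈ h ↔ W < votes g x W h 0) := by
    refine fun h hh => ⟨fun hyh => ?_, fun hv => hy h ⟨hh, hv⟩⟩
    by_contra hv
    refine hy hᶜ ⟨hh.compl, ?_⟩ hyh
    have := votes_compl g x W h 0
    omega
  refine ⟨y, fun h hh k => ?_⟩
  rw [← votes_smul, ← h0 _ (hh.smul _), zpow_neg, Set.mem_inv_smul_set_iff]

/-- The majority vote inherits monotonicity from step `N` to step `1`. The window length `W` is a
multiple of `N`, so moving the window by one replaces a voter by one at least as favourable; the
extra vote of the first voter could only be decisive if half of a window longer than `2 * L`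
voted against it, which the bound `L` excludes. -/
theorem majority_step {g : Aut M} {N L W : ℕ} {x : M} (hNW : N ∣ W) (hLW : 2 * L < W)
    {h : Set M} (hh : g ^ N • h ⊆ h)
    (hL : ∀ i j : ℤ, i + L ≤ j → g ^ i • x ∈ h → g ^ j • x ∈ h) {k : ℤ}
    (hk : W < votes g x W h k) : W < votes g x W h (k + 1) := by
  set s : ℕ → ℕ := fun i => h.indicator 1 (g ^ (k + i : ℤ) • x) with hs
  have hv : votes g x W h k = 2 * (∑ i ∈ Finset.range W, s i) + s 0 := by
    simp [votes, hs]
  have hv' : votes g x W h (k + 1) = 2 * (∑ i ∈ Finset.range W, s (i + 1)) + s 1 := by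
    simp only [votes, hs]
    push_cast
    simp only [add_assoc, add_comm (1 : ℤ)]
  have hs01 : s 0 ≤ s W := by
    simp only [hs]
    by_cases h1 : g ^ (k + (0 : ℕ) : ℤ) • x ∈ h
    · obtain ⟨m, rfl⟩ := hNW
      rw [Set.indicator_of_mem h1, Set.indicator_of_mem]
      · rfl
      have := zpow_smul_mem hh h1 m
      rw [← mul_smul, ← zpow_add] at this
      convert this using 3
      push_cast
      ring
    · rw [Set.indicator_of_notMem h1]
      exact Nat.zero_le _
  have hsum : (∑ i ∈ Finset.range W, s (i + 1)) + s 0 = (∑ i ∈ Finset.range W, s i) + s W := by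
    rw [← Finset.sum_range_succ', ← Finset.sum_range_succ]
  by_cases h0 : g ^ k • x ∈ h
  · -- if `g ^ k • x` votes for `h`, then so do all voters from the index `L` on
    have hge : W - L ≤ ∑ i ∈ Finset.range W, s i := by
      calc W - L = ∑ i ∈ Finset.Ico L W, 1 := by simp
        _ ≤ ∑ i ∈ Finset.Ico L W, s i := by
          refine Finset.sum_le_sum fun i hi => ?_
          have := hL k (k + i) (by have := (Finset.mem_Ico.1 hi).1; omega) h0
          simp [hs, this]
        _ ≤ ∑ i ∈ Finset.range W, s i := by
          refine Finset.sum_le_sum_of_subset fun i hi => ?_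
          exact Finset.mem_range.2 (Finset.mem_Ico.1 hi).2
    omega
  · have : s 0 = 0 := by simp [hs, h0]
    omega

/-! ### Semisimplicity -/

theorem isSemisimple_of_monotone {g : Aut M} {y : M}
    (hy : ∀ h : Set M, IsBiconvex h → (∀ k : ℤ, g ^ k • y ∈ h → g ^ (k + 1) • y ∈ h) ∨
      ∀ k : ℤ, g ^ k • y ∉ h → g ^ (k + 1) • y ∉ h) : IsSemisimple g := by
  have hsep : ∀ {a b : M} {h : Set M}, s(h, hᶜ) ∈ wallsBetween a b → ¬ (a ∈ h ↔ b ∈ h) := by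
    rintro a b h ⟨-, k, hk, ha, hb⟩
    rcases Sym2.mem_iff.1 hk with rfl | rfl
    · simp [ha, hb]
    · simp only [Set.mem_compl_iff, not_not] at ha hb
      simp [ha, hb]
  have hup : ∀ {P : ℤ → Prop}, (∀ k, P k → P (k + 1)) → ∀ {m n : ℤ}, m ≤ n → P m → P n := by
    intro P hP m n hmn hm
    induction n, hmn using Int.leInduction with
    | base => exact hm
    | succ n _ ih => exact hP n ih
  have key : ∀ {m n : ℤ}, m < n → Disjoint (wallsBetween (g ^ m • y) (g ^ (m + 1) • y))
      (wallsBetween (g ^ n • y) (g ^ (n + 1) • y)) := by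
    intro m n hmn
    rw [Set.disjoint_left]
    intro w hw hw'
    obtain ⟨⟨h, hh, rfl⟩, -⟩ := id hw
    have h1 := hsep hw
    have h2 := hsep hw'
    rcases hy h hh.isBiconvex with H | H
    · have h3 := hup H (show m + 1 ≤ n by omega)
      have h4 := H m
      have h5 := H n
      tauto
    · have h3 := hup H (show m + 1 ≤ n by omega)
      have h4 := H m
      have h5 := H n
      tauto
  refine ⟨y, fun m n hmn => ?_⟩
  rcases lt_or_gt_of_ne hmn with h | h
  · exact key h
  · exact (key h).symm

theorem isSemisimple_of_no_periodic [Nonempty M] {r : ℕ} (hr : rank M = r) {g : Aut M} {N : ℕ}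
    (hN : 1 ≤ N) {x : M} (hx : ∀ h ∈ orbitHalfspaces g x, g ^ N • h ≠ h)
    (hnest : ∀ h ∈ orbitHalfspaces g x, g ^ N • h ⊆ h ∨ h ⊆ g ^ N • h) : IsSemisimple g := by
  obtain ⟨L, hL⟩ := exists_uniform_bound hN hx
  set W := N * (2 * L + 1) with hW
  have hLW : 2 * L < W := by
    calc 2 * L < 1 * (2 * L + 1) := by omega
      _ ≤ W := Nat.mul_le_mul_right _ hN
  obtain ⟨y, hy⟩ := exists_majority hr g x W
  refine isSemisimple_of_monotone (y := y) fun h hh => ?_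
  have hstep : ∀ h ∈ descending g N x, ∀ k : ℤ, g ^ k • y ∈ h → g ^ (k + 1) • y ∈ h := by
    intro h hh k hk
    rw [hy h hh.1.1] at hk ⊢
    exact majority_step ⟨_, hW⟩ hLW hh.2 (hL h hh) hk
  -- a biconvex set containing the orbit of `x` contains the orbit of `y`
  have hconst : ∀ h, IsBiconvex h → (∀ i : ℤ, g ^ i • x ∈ h) → ∀ k : ℤ, g ^ k • y ∈ h := by
    intro h hh hxh k
    rw [hy h hh]
    simp only [votes, Set.indicator_of_mem (hxh _), Pi.one_apply, Finset.sum_const,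
      Finset.card_range, smul_eq_mul, mul_one]
    omega
  by_cases hmem : h ∈ orbitHalfspaces g x
  · rcases hnest h hmem with hsub | hsub
    · exact Or.inl (hstep h ⟨hmem, hsub⟩)
    · refine Or.inr (hstep hᶜ ⟨compl_mem_orbitHalfspaces hmem, ?_⟩)
      rw [Set.smul_set_compl]
      exact Set.compl_subset_compl.2 hsub
  · by_cases hall : ∀ i : ℤ, g ^ i • x ∈ h
    · exact Or.inl fun k _ => hconst h hh hall (k + 1)
    · refine Or.inr fun k _ => hconst hᶜ hh.compl (fun i hi => ?_) (k + 1)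
      push Not at hall
      exact hmem ⟨hh, ⟨i, hi⟩, hall⟩

theorem StablyWithoutWallInversions.isSemisimple [Nonempty M] {r : ℕ} (hr : rank M = r)
    {g : Aut M} (hg : StablyWithoutWallInversions g) : IsSemisimple g := by
  set N := r.factorial with hN
  have hN1 : 1 ≤ N := r.factorial_pos
  obtain ⟨x, hx⟩ := hg.exists_mem_core hr N
  -- halfspaces separating points of the orbit neither cover `M` with a translate nor miss it
  have hcov : ∀ h ∈ orbitHalfspaces g x, ∀ n : ℕ, 1 ≤ n → n ≤ N → h ∪ g ^ n • h ≠ Set.univ := by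
    rintro h ⟨hh, -, j, hj⟩ n hn hn' hcov
    exact hj (hx h hh n hn hn' hcov j)
  have hmeet : ∀ h ∈ orbitHalfspaces g x, ∀ n : ℕ, 1 ≤ n → n ≤ N →
      (h ∩ g ^ n • h).Nonempty := by
    intro h hh n hn hn'
    have := hcov _ (compl_mem_orbitHalfspaces hh) n hn hn'
    rwa [Set.smul_set_compl, ← Set.compl_inter, Set.compl_ne_univ] at this
  obtain ⟨y, hyx, hy⟩ := exists_no_periodic hr hN1 x hmeet
  refine isSemisimple_of_no_periodic hr hN1 hy fun h hh => ?_
  have hh' := hyx hh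
  obtain ⟨n, hn, hnr, H⟩ := exists_not_transverse hr g (isHalfspace_of_mem_orbitHalfspaces hh')
  obtain ⟨m, hm⟩ := Nat.dvd_factorial hn hnr
  have hnN : n ≤ N := hnr.trans r.self_le_factorial
  rw [← hN] at hm
  rw [hm, pow_mul]
  rcases H with H | H | H | H
  · exact absurd H (Set.not_disjoint_iff_nonempty_inter.2 (hmeet h hh' n hn hnN))
  · exact absurd H (hcov h hh' n hn hnN)
  · exact Or.inl (smul_pow_subset H m)
  · exact Or.inr (subset_smul_pow H m)

/-! ### Powers without wall inversions -/

theorem smul_eq_of_subset {g : Aut M} {h : Set M} (hsub : g • h ⊆ h) {n : ℕ} (hn : 1 ≤ n)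
    (hper : g ^ n • h = h) : g • h = h := by
  refine hsub.antisymm ?_
  obtain ⟨m, rfl⟩ := Nat.exists_eq_add_of_le' hn
  calc h = g • g ^ m • h := by rw [← mul_smul, ← pow_succ', hper]
    _ ⊆ g • h := Set.smul_set_mono (smul_pow_subset hsub m)

/-- In rank `r`, an automorphism whose power with exponent `2 ^ r` inverts a wall would have too
many transverse translates of that wall. -/
theorem pow_two_pow_smul_ne_compl [Nonempty M] {r : ℕ} (hr : rank M = r) (γ : Aut M) {h : Set M}
    (hh : IsHalfspace h) : γ ^ 2 ^ r • h ≠ hᶜ := by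
  intro hinv
  have hinv' : γ ^ 2 ^ r • hᶜ = h := by rw [Set.smul_set_compl, hinv, compl_compl]
  have hper : γ ^ (2 * 2 ^ r) • h = h := by
    rw [two_mul, pow_add, mul_smul, hinv, hinv']
  have hne : h ≠ hᶜ := fun heq => by
    obtain ⟨x, hx⟩ := hh.1
    exact (heq.subset hx) hx
  obtain ⟨n, hn, hnr, H⟩ := exists_not_transverse hr γ hh
  have hperm : ∀ m : ℕ, (γ ^ m) ^ (2 * 2 ^ r) • h = h := by
    intro m
    rw [← pow_mul, mul_comm, pow_mul]
    exact smul_pow_eq hper m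
  have hpos : 1 ≤ 2 * 2 ^ r := by have := Nat.one_le_two_pow (n := r); omega
  have hsup : ∀ m : ℕ, h ⊆ γ ^ m • h → γ ^ m • h = h := by
    intro m hm
    have h1 : γ ^ m • hᶜ ⊆ hᶜ := by
      rw [Set.smul_set_compl]; exact Set.compl_subset_compl.2 hm
    have h2 := smul_eq_of_subset h1 hpos (by rw [Set.smul_set_compl, hperm])
    rwa [Set.smul_set_compl, compl_inj_iff] at h2
  have hcase : γ ^ n • h = h ∨ γ ^ n • h = hᶜ := by
    have hswap : γ ^ (n + 2 ^ r) • h = (γ ^ n • h)ᶜ := by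
      rw [pow_add, mul_smul, hinv, Set.smul_set_compl]
    have hconv : γ ^ (n + 2 ^ r) • h = h → γ ^ n • h = hᶜ := by
      intro h1
      rw [hswap] at h1
      rw [← compl_compl (γ ^ n • h), h1]
    rcases H with H | H | H | H
    · refine Or.inr (hconv (hsup _ ?_))
      rw [hswap]; exact H.subset_compl_right
    · refine Or.inr (hconv (smul_eq_of_subset ?_ hpos (hperm _)))
      rw [hswap, Set.compl_subset_iff_union, Set.union_comm]; exact H
    · exact Or.inl (smul_eq_of_subset H hpos (hperm n))
    · exact Or.inl (hsup n H)
  have hper2 : (γ ^ n) ^ 2 • h = h := by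
    rw [pow_two, mul_smul]
    rcases hcase with h1 | h1
    · rw [h1, h1]
    · rw [h1, Set.smul_set_compl, h1, compl_compl]
  -- `n = 2 ^ f * o` with `o` odd and `f < r`, so `γ ^ (2 ^ r * o)` both fixes and inverts `h`
  obtain ⟨f, o, ho, hfo⟩ := Nat.exists_eq_two_pow_mul_odd (n := n) (by omega)
  have hfr : f < r := by
    by_contra hfr
    have h1 : 2 ^ r ≤ 2 ^ f := Nat.pow_le_pow_right (by norm_num) (by omega)
    have h2 : 2 ^ f ≤ n := by
      rw [hfo]; exact Nat.le_mul_of_pos_right _ ho.pos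
    have h3 := Nat.lt_two_pow_self (n := r)
    omega
  have hfix : γ ^ (2 ^ r * o) • h = h := by
    have h1 : 2 ^ r * o = n * 2 * 2 ^ (r - f - 1) := by
      have : r = f + 1 + (r - f - 1) := by omega
      rw [hfo]
      nth_rewrite 1 [this]
      rw [pow_add, pow_add]
      ring
    rw [h1, pow_mul, pow_mul]
    exact smul_pow_eq hper2 _
  obtain ⟨t, rfl⟩ := ho
  have hflip : γ ^ (2 ^ r * (2 * t + 1)) • h = hᶜ := by
    have h1 : 2 ^ r * (2 * t + 1) = 2 ^ r + 2 * 2 ^ r * t := by ring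
    have h2 : (γ ^ (2 * 2 ^ r)) ^ t • h = h := smul_pow_eq hper t
    rw [h1, pow_add, mul_smul, pow_mul, h2, hinv]
  exact hne (hfix.symm.trans hflip)

theorem stablyWithoutWallInversions_pow [Nonempty M] {r : ℕ} (hr : rank M = r) (g : Aut M) :
    StablyWithoutWallInversions (g ^ 2 ^ r) := by
  rintro ⟨h, ⟨_, t, rfl⟩, hh, heq⟩
  refine pow_two_pow_smul_ne_compl hr (g ^ t) hh ?_
  have h1 : (g ^ 2 ^ r) ^ t • h = hᶜ := heq
  rwa [← zpow_natCast, ← zpow_mul, mul_comm, zpow_mul, zpow_natCast] at h1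

end MedianAlgebra

theorem corollaryC {M : Type*} [MedianAlgebra M] [Nonempty M]
    (r : ℕ) (hr : MedianAlgebra.rank M = (r : ℕ∞)) :
    (∀ g : MedianAlgebra.Aut M,
      MedianAlgebra.StablyWithoutWallInversions g → MedianAlgebra.IsSemisimple g) ∧
    (∀ g : MedianAlgebra.Aut M,
      ∃ i : ℕ, 1 ≤ i ∧ i ≤ 2 ^ r ∧ MedianAlgebra.IsSemisimple (g ^ i)) :=
  ⟨fun _ hg => hg.isSemisimple hr, fun g => ⟨2 ^ r, Nat.one_le_two_pow, le_rfl,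
    (MedianAlgebra.stablyWithoutWallInversions_pow hr g).isSemisimple hr⟩⟩
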